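/- A \emph{tensor network template} $\mathsf{Temp}=(G,d,V_{\rm filled})$ consists of a finite oriented graph $G=(V,E)$ (no loops, no bidirected edges), a dimension $d(e)\in\{1,2,\dots\}$ for each edge $e$, and a set $V_{\rm filled}\subseteq V$ such that every vertex outside $V_{\rm filled}$ (an \emph{empty} vertex) is adjacent to exactly one vertex, and that vertex is filled. Edge $e$ carries the Hilbert space $\mathbb C^{d(e)}$; ingoing (outgoing) edges are those from an empty to a filled (from a filled to an empty) vertex, and $\mathcal H_{\rm in}$, $\mathcal H_{\rm out}$ are the tensor products of the spaces of the ingoing, respectively outgoing, edges. Placing at every filled vertex an arbitrary complex tensor with one index per incident edge (ranging over $d(e)$ values), and contracting along the internal edges (those between filled vertices), gives an operator $N_*:\mathcal H_{\rm in}\to\mathcal H_{\rm out}$; the operators so obtained are called \emph{compatible} with $\mathsf{Temp}$. Let $$\textsf{quantum-max-flow}=\max_{N_*\ \text{compatible}}\log_2\operatorname{rank}(N_*),\qquad Q_{\min}=\lceil\textsf{quantum-max-flow}\rceil .$$ The \emph{flow network} $\widetilde{\mathsf{Temp}}$ has as vertices the filled vertices together with a source $s$ and a sink $t$; each ingoing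 edge $(u,v)$ gives an edge $(s,v)$, each outgoing edge $(v,u)$ gives an edge $(v,t)$, and each internal edge $(v,w)$ gives the two edges $(v,w)$ and $(w,v)$, all of capacity $\log_2$ of the dimension of the original edge (parallel edges are kept). Let $\textsf{min-cut}$ be the minimum, over all partitions of the vertices into $C_s\ni s$ and $C_t\ni t$, of the total capacity of the edges from $C_s$ to $C_t$, and let $Q_{\rm cut}=\lceil\textsf{min-cut}\rceil$. \textbf{Proposition.} Suppose that there are an integer $b$ and a function $n:E\to\mathbb N$ with $d(e)=b^{n(e)}$ for every edge $e$. Then $\textsf{quantum-max-flow}=\textsf{min-cut}$, and hence $Q_{\rm cut}=Q_{\min}$. Moreover, $Q_{\rm cut}$ is the minimum number of memory qubits in the worst case over all state families with the given template: it is the least $Q\in\mathbb N$ such that every family of unit vectors $\{N_*|v_x\rangle\}_{x\in X}$ in $\mathcal H_{\rm out}$, with $N_*$ compatible with $\mathsf{Temp}$ and $|v_x\rangle\in\mathcal H_{\rm in}$, can be compressed exactly into $Q$ qubits, that is, there are completely positive trace-preserving maps $\mathcal E$ from operators on $\mathcal H_{\rm out}$ to operators on $(\mathbb C^2)^{\otimes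 Q}$ and $\mathcal D$ in the opposite direction, independent of $x$, with $\mathcal D(\mathcal E(|\Psi_x\rangle\langle\Psi_x|))=|\Psi_x\rangle\langle\Psi_x|$ for all $x$, where $|\Psi_x\rangle=N_*|v_x\rangle$. -/

import Mathlib

universe u

noncomputable section

open scoped ComplexOrder

namespace TensorNetwork

/-! ### Quantum channels and exact compression -/

/-- A linear map on matrices is completely positive if, for every `k`, its ampliation by the
identity on `k × k` matrices sends positive semidefinite matrices to positive semidefinite ones. -/
def IsCompletelyPositive {P M : Type*} [Fintype P] [Fintype M]
    (Φ : Matrix P P ℂ →ₗ[ℂ] Matrix M M ℂ) : Prop :=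
  ∀ (k : ℕ) (A : Matrix (Fin k × P) (Fin k × P) ℂ), A.PosSemidef →
    (Matrix.of fun p q : Fin k × M =>
      Φ (Matrix.of fun a b => A (p.1, a) (q.1, b)) p.2 q.2).PosSemidef

/-- A quantum channel: a completely positive trace-preserving linear map. -/
def IsChannel {P M : Type*} [Fintype P] [Fintype M]
    (Φ : Matrix P P ℂ →ₗ[ℂ] Matrix M M ℂ) : Prop :=
  IsCompletelyPositive Φ ∧ ∀ A, (Φ A).trace = A.trace

/-- The rank-one operator `|ψ⟩⟨ψ|`. -/
def pureState {P : Type*} (ψ : P → ℂ) : Matrix P P ℂ :=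
  Matrix.vecMulVec ψ (star ψ)

/-- The family of pure states `|ψ x⟩⟨ψ x|` can be compressed without errors into `Q` memory
qubits: there are an encoding and a decoding channel, both independent of `x`, whose composition
fixes every state of the family. The memory space is `(ℂ²)^{⊗ Q}`. -/
def ExactlyCompressible {P X : Type*} [Fintype P] (ψ : X → P → ℂ) (Q : ℕ) : Prop :=
  ∃ (enc : Matrix P P ℂ →ₗ[ℂ] Matrix (Fin Q → Fin 2) (Fin Q → Fin 2) ℂ)
    (dec : Matrix (Fin Q → Fin 2) (Fin Q → Fin 2) ℂ →ₗ[ℂ] Matrix P P ℂ),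
    IsChannel enc ∧ IsChannel dec ∧ ∀ x, dec (enc (pureState (ψ x))) = pureState (ψ x)

/-! ### Flow networks -/

/-- A flow network on the vertex set `W` with edges labelled by `A` (parallel edges are
allowed). -/
structure FlowNetwork (W A : Type*) where
  src : A → W
  tgt : A → W
  cap : A → ℝ
  cap_nonneg : ∀ a, 0 ≤ cap a
  s : W
  t : W
  s_ne_t : s ≠ t

namespace FlowNetwork

variable {W A : Type*}

/-- A cut `(C_s, C_t)`, given by the source side `C_s`; the sink side `C_t` is its complement. -/
def IsCut (N : FlowNetwork W A) (C : Set W) : Prop :=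
  N.s ∈ C ∧ N.t ∉ C

open Classical in
/-- The capacity of a cut: the sum of the capacities of the edges leading from `C` to its
complement. -/
def cutCapacity [Fintype A] (N : FlowNetwork W A) (C : Set W) : ℝ :=
  ∑ a : A, if N.src a ∈ C ∧ N.tgt a ∉ C then N.cap a else 0

/-- The minimum cut. -/
def minCut [Fintype A] (N : FlowNetwork W A) : ℝ :=
  sInf {c : ℝ | ∃ C : Set W, N.IsCut C ∧ c = N.cutCapacity C}

/-- The infimum in `minCut` is a minimum. -/
theorem isLeast_minCut [Finite W] [Fintype A] (N : FlowNetwork W A) :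
    IsLeast {c : ℝ | ∃ C : Set W, N.IsCut C ∧ c = N.cutCapacity C} N.minCut := by
  have hfin : {c : ℝ | ∃ C : Set W, N.IsCut C ∧ c = N.cutCapacity C}.Finite :=
    (Set.finite_range N.cutCapacity).subset (by rintro c ⟨C, -, rfl⟩; exact ⟨C, rfl⟩)
  have hne : {c : ℝ | ∃ C : Set W, N.IsCut C ∧ c = N.cutCapacity C}.Nonempty :=
    ⟨_, {N.s}, ⟨rfl, fun h => N.s_ne_t h.symm⟩, rfl⟩
  exact ⟨hne.csInf_mem hfin, fun c hc => csInf_le hfin.bddBelow hc⟩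

end FlowNetwork

/-! ### Tensor network templates -/

/-- A tensor network template on the finite vertex set `V`: an oriented graph (no loops, no
bidirected edges), a positive dimension for each edge, and a set of filled vertices such that each
remaining (empty) vertex is adjacent to exactly one vertex, which is filled. -/
structure Template (V : Type u) where
  /-- the edges -/
  E : Finset (V × V)
  oriented : ∀ v w, (v, w) ∈ E → (w, v) ∉ E
  /-- the dimension of each edge -/
  d : E → ℕ
  d_pos : ∀ e, 0 < d e
  /-- the filled vertices -/
  filled : Finset V
  empty_adj : ∀ v, v ∉ filled →
    ∃ w ∈ filled, ∀ x, ((v, x) ∈ E ∨ (x, v) ∈ E) ↔ x = w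

namespace Template

variable {V : Type u} [DecidableEq V] (T : Template V)

/-- Ingoing edges: from an empty vertex to a filled one. -/
abbrev InEdge : Type u := {e : T.E // e.1.1 ∉ T.filled ∧ e.1.2 ∈ T.filled}

/-- Outgoing edges: from a filled vertex to an empty one. -/
abbrev OutEdge : Type u := {e : T.E // e.1.1 ∈ T.filled ∧ e.1.2 ∉ T.filled}

/-- Internal edges: between two filled vertices. -/
abbrev InternalEdge : Type u := {e : T.E // e.1.1 ∈ T.filled ∧ e.1.2 ∈ T.filled}

/-- Edges incident on the vertex `v`. -/
abbrev IncidentEdge (v : V) : Type u := {e : T.E // e.1.1 = v ∨ e.1.2 = v}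

/-- The default basis of the input Hilbert space (the tensor product over the ingoing edges). -/
abbrev InIndex : Type u := ∀ e : T.InEdge, Fin (T.d e.1)

/-- The default basis of the output Hilbert space (the tensor product over the outgoing edges). -/
abbrev OutIndex : Type u := ∀ e : T.OutEdge, Fin (T.d e.1)

/-- A filling of the template: a tensor for every filled vertex, with one index for each incident
edge, ranging over the dimension of that edge. -/
abbrev Filling : Type u :=
  ∀ v : T.filled, (∀ e : T.IncidentEdge v.1, Fin (T.d e.1)) → ℂ

variable {T} in
/-- The tensor network operator of a filling, as a matrix in the default bases: all tensors are
multiplied and the indices of the internal edges are summed over, the indices of the open edges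
being fixed by `i` and `o`. -/
def operator (N : T.Filling) : Matrix T.OutIndex T.InIndex ℂ :=
  Matrix.of fun o i =>
    ∑ a : (∀ e : T.E, Fin (T.d e)),
      if (∀ e : T.InEdge, a e.1 = i e) ∧ (∀ e : T.OutEdge, a e.1 = o e) then
        ∏ v : T.filled, N v (fun e => a e.1)
      else 0

/-- An operator is compatible with the template if it is the operator of some filling. -/
def Compatible (A : Matrix T.OutIndex T.InIndex ℂ) : Prop :=
  ∃ N : T.Filling, A = operator N

/-- The quantum max-flow: the maximum of `log₂ (rank A)` over the compatible operators `A`. (The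
zero operator contributes `Real.logb 2 0 = 0`; this does not affect the maximum, since there are
compatible operators of nonzero rank.) -/
def quantumMaxFlow : ℝ :=
  sSup {q : ℝ | ∃ A : Matrix T.OutIndex T.InIndex ℂ, T.Compatible A ∧ q = Real.logb 2 A.rank}

/-- The supremum in `quantumMaxFlow` is a maximum. -/
theorem isGreatest_quantumMaxFlow :
    IsGreatest {q : ℝ | ∃ A : Matrix T.OutIndex T.InIndex ℂ,
      T.Compatible A ∧ q = Real.logb 2 A.rank} T.quantumMaxFlow := by
  have hfin : {q : ℝ | ∃ A : Matrix T.OutIndex T.InIndex ℂ,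
      T.Compatible A ∧ q = Real.logb 2 A.rank}.Finite := by
    refine ((Set.finite_Iic (Fintype.card T.InIndex)).image
      (fun r : ℕ => Real.logb 2 r)).subset ?_
    rintro q ⟨A, -, rfl⟩
    exact ⟨A.rank, A.rank_le_card_width, rfl⟩
  have hne : {q : ℝ | ∃ A : Matrix T.OutIndex T.InIndex ℂ,
      T.Compatible A ∧ q = Real.logb 2 A.rank}.Nonempty :=
    ⟨_, _, ⟨fun _ _ => 0, rfl⟩, rfl⟩
  exact ⟨hne.csSup_mem hfin, fun c hc => le_csSup hfin.bddAbove hc⟩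

/-- Vertices of the associated flow network: the filled vertices, a source `inr false` and a sink
`inr true`. -/
abbrev FlowVertex : Type u := T.filled ⊕ Bool

/-- Edges of the associated flow network: one for each ingoing edge, one for each outgoing edge,
and two for each internal edge (one in each direction). -/
abbrev FlowEdge : Type u := (T.InEdge ⊕ T.OutEdge) ⊕ (T.InternalEdge ⊕ T.InternalEdge)

/-- The template edge from which an edge of the flow network arises. -/
def FlowEdge.base : T.FlowEdge → T.E :=
  Sum.elim (Sum.elim (fun e => e.1) (fun e => e.1)) (Sum.elim (fun e => e.1) (fun e => e.1))

/-- The flow network associated to the template: ingoing edges `(v, w)` become `(s, w)`, outgoing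
edges `(v, w)` become `(v, t)`, internal edges are doubled into `(v, w)` and `(w, v)`, and each
edge has capacity `log₂` of the dimension of the template edge from which it arises. -/
def flowNetwork : FlowNetwork T.FlowVertex T.FlowEdge where
  src := Sum.elim
    (Sum.elim (fun _ => Sum.inr false) (fun e => Sum.inl ⟨e.1.1.1, e.2.1⟩))
    (Sum.elim (fun e => Sum.inl ⟨e.1.1.1, e.2.1⟩) (fun e => Sum.inl ⟨e.1.1.2, e.2.2⟩))
  tgt := Sum.elim
    (Sum.elim (fun e => Sum.inl ⟨e.1.1.2, e.2.2⟩) (fun _ => Sum.inr true))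
    (Sum.elim (fun e => Sum.inl ⟨e.1.1.2, e.2.2⟩) (fun e => Sum.inl ⟨e.1.1.1, e.2.1⟩))
  cap a := Real.logb 2 (T.d (FlowEdge.base T a))
  cap_nonneg a := Real.logb_nonneg (by norm_num) (by exact_mod_cast T.d_pos _)
  s := Sum.inr false
  t := Sum.inr true
  s_ne_t := by simp

/-- The number of qubits given by the minimum cut. -/
def Qcut : ℕ := ⌈T.flowNetwork.minCut⌉₊

/-- The number of qubits given by the quantum max-flow. -/
def Qmin : ℕ := ⌈T.quantumMaxFlow⌉₊

/-- A parametric family of tensor network states with template `T`: unit vectors `A |v x⟩`, where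
`A` is a fixed operator compatible with `T` and the `v x` are arbitrary (not necessarily
normalised) vectors of the input space. -/
def IsStateFamily {X : Type*} (ψ : X → T.OutIndex → ℂ) : Prop :=
  ∃ (A : Matrix T.OutIndex T.InIndex ℂ) (v : X → T.InIndex → ℂ), T.Compatible A ∧
    ∀ x, ψ x = A.mulVec (v x) ∧ ∑ o, ‖ψ x o‖ ^ 2 = 1

/-- `Q` memory qubits suffice for the exact compression of every state family with template `T`. -/
def SufficientMemory (Q : ℕ) : Prop :=
  ∀ (X : Type u) (ψ : X → T.OutIndex → ℂ), T.IsStateFamily ψ → ExactlyCompressible ψ Q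

end Template

end TensorNetwork

end

/-! For any cut, grouping the tensors on its source side and those on its sink side factors the
operator through the crossing edges. Its rank is thus at most the product of their dimensions, so
the quantum max-flow never exceeds the min-cut (`rank_le_prod`).

For the converse, with `d e = b ^ n e`, replace each edge by `n e` parallel slots of dimension `b`.
Every capacity is then an integer multiple of `logb 2 b`, and the min-cut equals `k * logb 2 b` for
an integer `k`. Menger's theorem in the line graph of the slots (`exists_disjoint_chains`, deduced
from Hall's theorem) yields `k` disjoint chains from inputs to outputs. Tensors forcing equal digits
along each chain transmit `k` independent digits, so the rank is at least `b ^ k`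
(`pow_le_rank_linkFilling`).

Memory: the unit vectors of an `r`-dimensional space fit exactly into `Q` qubits if and only if `r ≤
2 ^ Q`. A partial isometry gives the channels. Conversely, the `r ^ 2` operators `|e i⟩⟨e j|` must
stay linearly independent after encoding. Hence `Qmin` is the worst-case memory
(`sufficientMemory_iff`). -/

noncomputable section

open scoped ComplexOrder

namespace TensorNetwork

/-! ### Menger's theorem from Hall's theorem -/

open Relation

/-- The bipartite relation whose perfect matchings are the systems of `k` disjoint paths from `A`
to `B` (completed by cycles and fixed points). -/
def LinkRel {α : Type*} (r : α → α → Prop) (A B : Set α) (k : ℕ) :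
    α ⊕ Fin k → α ⊕ Fin k → Prop
  | .inl u, .inl v => u = v ∨ r u v
  | .inl u, .inr _ => u ∈ B
  | .inr _, .inl v => v ∈ A
  | .inr _, .inr _ => False

/-- If every set separating `A` from `B` has at least `k` elements, then the link relation
satisfies Hall's condition. -/
theorem exists_injective_linkRel {α : Type*} [Finite α] (r : α → α → Prop) (A B : Set α) (k : ℕ)
    (h : ∀ S : Finset α, (∀ x ∈ A, ∀ y ∈ B, x ∉ S →
      ¬ ReflTransGen (fun u v => r u v ∧ v ∉ S) x y) → k ≤ S.card) :
    ∃ f : α ⊕ Fin k → α ⊕ Fin k, Function.Injective f ∧ ∀ p, LinkRel r A B k p (f p) := by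
  classical
  have := Fintype.ofFinite α
  refine (Fintype.all_card_le_filter_rel_iff_exists_injective (LinkRel r A B k)).1 fun T => ?_
  set U : Finset α := Finset.univ.filter fun u => Sum.inl u ∈ T with hU
  set D : Finset (Fin k) := Finset.univ.filter fun j => Sum.inr j ∈ T with hD
  have hT : T.card = U.card + D.card := by
    have : T = U.disjSum D := by
      ext p; cases p <;> simp [hU, hD]
    rw [this, Finset.card_disjSum]
  have hDk : D.card ≤ k := by simpa using D.card_le_univ
  by_cases hUB : ∃ u ∈ U, u ∈ B
  · obtain ⟨u, hu, huB⟩ := hUB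
    -- Each element of `U` is its own neighbour, and a single `u ∈ B` is joined to all of `Fin k`.
    have hsub : U.disjSum (Finset.univ : Finset (Fin k)) ⊆
        Finset.univ.filter fun q => ∃ p ∈ T, LinkRel r A B k p q := by
      intro q hq
      simp only [Finset.mem_filter, Finset.mem_univ, true_and]
      rcases q with v | j
      · exact ⟨.inl v, by simpa [hU] using hq, Or.inl rfl⟩
      · exact ⟨.inl u, by simpa [hU] using hu, huB⟩
    have := Finset.card_le_card hsub
    rw [Finset.card_disjSum, Finset.card_univ, Fintype.card_fin] at this
    omega
  push Not at hUB
  rcases D.eq_empty_or_nonempty with hD0 | ⟨j, hj⟩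
  · have hsub : U.map .inl ⊆ Finset.univ.filter fun q => ∃ p ∈ T, LinkRel r A B k p q := by
      intro q hq
      obtain ⟨v, hv, rfl⟩ := Finset.mem_map.1 hq
      simp only [Finset.mem_filter, Finset.mem_univ, true_and]
      exact ⟨.inl v, by simpa [hU] using hv, Or.inl rfl⟩
    have := Finset.card_le_card hsub
    rw [Finset.card_map] at this
    simpa [hT, hD0] using this
  · set N : Finset α := Finset.univ.filter fun v => v ∈ U ∨ (∃ u ∈ U, r u v) ∨ v ∈ A with hN
    have hUN : U ⊆ N := fun v hv => by simp [hN, hv]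
    -- `N \ U` separates `A` from `B`: since `A ⊆ N`, a chain from `A` avoiding it starts in `U`. It
    -- cannot leave `U`, because successors of `U` lie in `N`; and `U` misses `B`.
    have hS : k ≤ (N \ U).card := by
      refine h _ fun x hx y hy hxS hxy => ?_
      have hxU : x ∈ U := by
        by_contra hxU
        exact hxS (by simp [hN, hx, hxU])
      have : y ∈ U := by
        clear hy
        induction hxy with
        | refl => exact hxU
        | tail _ hbc ih =>
          by_contra hc
          exact hbc.2 (Finset.mem_sdiff.2 ⟨by simpa [hN] using Or.inr (Or.inl ⟨_, ih, hbc.1⟩), hc⟩)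
      exact hUB y this hy
    have hsub : N.map .inl ⊆ Finset.univ.filter fun q => ∃ p ∈ T, LinkRel r A B k p q := by
      intro q hq
      obtain ⟨v, hv, rfl⟩ := Finset.mem_map.1 hq
      simp only [Finset.mem_filter, Finset.mem_univ, true_and]
      rcases (Finset.mem_filter.1 hv).2 with hv | ⟨u, hu, huv⟩ | hv
      · exact ⟨.inl v, by simpa [hU] using hv, Or.inl rfl⟩
      · exact ⟨.inl u, by simpa [hU] using hu, Or.inr huv⟩
      · exact ⟨.inr j, by simpa [hD] using hj, hv⟩
    have h1 := Finset.card_le_card hsub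
    rw [Finset.card_map] at h1
    have h2 := Finset.card_sdiff_add_card_eq_card hUN
    omega

/-- **Menger's theorem**, vertex version, for a relation on a finite type: if every set separating
`A` from `B` has at least `k` elements, there are `k` disjoint sets each containing a chain
from `A` to `B`. -/
theorem exists_disjoint_chains {α : Type*} [Finite α] (r : α → α → Prop) (A B : Set α) (k : ℕ)
    (h : ∀ S : Finset α, (∀ x ∈ A, ∀ y ∈ B, x ∉ S →
      ¬ ReflTransGen (fun u v => r u v ∧ v ∉ S) x y) → k ≤ S.card) :
    ∃ F : Fin k → Set α, (∀ i j x, x ∈ F i → x ∈ F j → i = j) ∧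
      ∀ j, ∃ x ∈ A, ∃ y ∈ B, x ∈ F j ∧ ReflTransGen (fun u v => r u v ∧ u ∈ F j ∧ v ∈ F j) x y := by
  obtain ⟨f, hf, hfr⟩ := exists_injective_linkRel r A B k h
  have hstart : ∀ j, ∃ x ∈ A, f (.inr j) = .inl x := by
    intro j
    have := hfr (.inr j)
    rcases hfj : f (.inr j) with x | i <;> rw [hfj] at this
    · exact ⟨x, this, rfl⟩
    · exact this.elim
  choose x hxA hx using hstart
  set step : α → α → Prop := fun u v => f (.inl u) = .inl v
  have inj : ∀ u v w, step u w → step v w → u = v := fun u v w h1 h2 =>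
    Sum.inl_injective (hf (h1.trans h2.symm))
  have nopred : ∀ u j, ¬ step u (x j) := fun u j hu => by
    have := hf (hu.trans (hx j).symm)
    simp at this
  refine ⟨fun j => {v | ReflTransGen step (x j) v}, ?_, fun j => ?_⟩
  · have key : ∀ i j v, ReflTransGen step (x i) v → ReflTransGen step (x j) v → x i = x j := by
      intro i j v hi
      induction hi with
      | refl =>
        intro hj
        rcases hj.cases_tail with h | ⟨w, -, hw⟩
        · exact h
        · exact (nopred _ _ hw).elim
      | tail _ hbc ih =>
        intro hj
        rcases hj.cases_tail with h | ⟨w, hjw, hw⟩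
        · subst h; exact (nopred _ _ hbc).elim
        · rw [inj _ _ _ hw hbc] at hjw
          exact ih hjw
    intro i j v hi hj
    have := key i j v hi hj
    exact Sum.inr_injective (hf (by rw [hx, hx, this]))
  -- An orbit that never left `α` would be finite and mapped injectively, hence surjectively, to
  -- itself, giving `x j` a predecessor.
  · have hend : ∃ y, ReflTransGen step (x j) y ∧ ∃ i, f (.inl y) = .inr i := by
      by_contra hcon
      push Not at hcon
      have hnext : ∀ y : {y // ReflTransGen step (x j) y},
          ∃ z : {y // ReflTransGen step (x j) y}, f (.inl y.1) = .inl z.1 := by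
        rintro ⟨y, hy⟩
        rcases hfy : f (.inl y) with z | i
        · exact ⟨⟨z, hy.tail hfy⟩, rfl⟩
        · exact (hcon y hy i hfy).elim
      choose g hg using hnext
      have hginj : Function.Injective g := fun y z hyz =>
        Subtype.ext (Sum.inl_injective (hf (by rw [hg, hg, hyz])))
      obtain ⟨y, hy⟩ := Finite.injective_iff_surjective.1 hginj ⟨x j, .refl⟩
      exact nopred y.1 j ((hg y).trans (by rw [hy]))
    obtain ⟨y, hxy, i, hi⟩ := hend
    refine ⟨x j, hxA j, y, ?_, .refl, ?_⟩
    · have := hfr (.inl y)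
      rwa [hi] at this
    · clear hi
      induction hxy with
      | refl => exact .refl
      | @tail b c hb hbc ih =>
        have hbc' := hfr (.inl b)
        rw [show f (.inl b) = .inl c from hbc] at hbc'
        rcases hbc' with rfl | hr
        · exact ih
        · exact ih.tail ⟨hr, hb, hb.tail hbc⟩


open Matrix

/-! ### Channels in Kraus form -/

/-- The linear map `ρ ↦ ∑ i, K i ρ (K i)ᴴ`. -/
def krausMap {P M ι : Type*} [Fintype P] [Fintype ι] (K : ι → Matrix M P ℂ) :
    Matrix P P ℂ →ₗ[ℂ] Matrix M M ℂ where
  toFun ρ := ∑ i, K i * ρ * (K i)ᴴ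
  map_add' ρ σ := by simp [Matrix.mul_add, Matrix.add_mul, Finset.sum_add_distrib]
  map_smul' c ρ := by simp [Finset.smul_sum]

/-- The ampliation is again in Kraus form, with operators `1 ⊗ K i`, so positivity survives; the
trace condition is cyclicity. -/
theorem isChannel_krausMap {P M ι : Type*} [Fintype P] [DecidableEq P] [Fintype M] [Fintype ι]
    (K : ι → Matrix M P ℂ) (hK : ∑ i, (K i)ᴴ * K i = 1) : IsChannel (krausMap K) := by
  refine ⟨fun k A hA => ?_, fun A => ?_⟩
  · have : (Matrix.of fun p q : Fin k × M =>
        krausMap K (Matrix.of fun a b => A (p.1, a) (q.1, b)) p.2 q.2) =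
        ∑ i, (Matrix.of fun (p : Fin k × M) (a : Fin k × P) =>
          if p.1 = a.1 then K i p.2 a.2 else 0) * A *
          (Matrix.of fun (p : Fin k × M) (a : Fin k × P) =>
          if p.1 = a.1 then K i p.2 a.2 else 0)ᴴ := by
      ext ⟨p, m⟩ ⟨q, m'⟩
      simp only [krausMap, LinearMap.coe_mk, AddHom.coe_mk, Matrix.sum_apply, Matrix.of_apply]
      refine Finset.sum_congr rfl fun i _ => ?_
      simp only [Matrix.mul_apply, Matrix.conjTranspose_apply, Matrix.of_apply,
        Fintype.sum_prod_type, ite_mul, zero_mul, apply_ite star, star_zero, mul_ite, mul_zero]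
      simp [Finset.sum_ite_irrel]
    rw [this]
    exact Matrix.posSemidef_sum _ fun i _ => hA.mul_mul_conjTranspose_same _
  · simp only [krausMap, LinearMap.coe_mk, AddHom.coe_mk, Matrix.trace_sum]
    simp_rw [Matrix.mul_assoc, Matrix.trace_mul_comm (K _), Matrix.mul_assoc]
    rw [← Matrix.trace_sum, ← Matrix.mul_sum, hK, Matrix.mul_one]

/-- If `KᴴK` is a projection then `ρ ↦ K ρ Kᴴ` extends to a channel which acts in this way on
all pure states in the range of the projection. -/
theorem exists_isChannel_of_isIdempotentElem {P M : Type*} [Fintype P] [Fintype M]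
    [Nonempty M] (K : Matrix M P ℂ) (hK : IsIdempotentElem (Kᴴ * K)) :
    ∃ Φ : Matrix P P ℂ →ₗ[ℂ] Matrix M M ℂ, IsChannel Φ ∧
      ∀ ψ, (Kᴴ * K) *ᵥ ψ = ψ → Φ (pureState ψ) = pureState (K *ᵥ ψ) := by
  classical
  obtain ⟨m⟩ := ‹Nonempty M›
  set R : Matrix P P ℂ := 1 - Kᴴ * K with hR
  have hRH : Rᴴ = R := by simp [hR]
  have hRR : R * R = R := hK.one_sub
  -- The additional operators `|m⟩⟨p| R` send the complement of the projection to one fixed basis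
  -- state. They contribute `R` to the sum of the `LᴴL`, completing it to `1`, and they kill the
  -- vectors fixed by the projection.
  let L : Option P → Matrix M P ℂ := fun o => o.elim K fun p => single m p (1 : ℂ) * R
  refine ⟨krausMap L, isChannel_krausMap L ?_, fun ψ hψ => ?_⟩
  · rw [Fintype.sum_option]
    have : ∀ p, (L (some p))ᴴ * L (some p) = R * single p p 1 * R := fun p => by
      change (single m p 1 * R)ᴴ * (single m p 1 * R) = _
      rw [conjTranspose_mul, hRH, conjTranspose_single, star_one, Matrix.mul_assoc,
        ← Matrix.mul_assoc (single p m 1), Matrix.single_mul_single_same,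
        mul_one, Matrix.mul_assoc]
    simp_rw [this]
    have hone : ∑ p : P, single p p (1 : ℂ) = 1 :=
      (sum_single_eq_diagonal _).trans diagonal_one
    rw [← Matrix.sum_mul, ← Matrix.mul_sum, hone, Matrix.mul_one, hRR]
    exact add_sub_cancel _ _
  · have hRψ : R *ᵥ ψ = 0 := by rw [hR, sub_mulVec, one_mulVec, hψ, sub_self]
    have hpure : ∀ N : Matrix M P ℂ, N * pureState ψ * Nᴴ = pureState (N *ᵥ ψ) := fun N => by
      rw [pureState, pureState, mul_vecMulVec, vecMulVec_mul, star_mulVec]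
    change ∑ o, L o * pureState ψ * (L o)ᴴ = _
    simp_rw [hpure]
    rw [Fintype.sum_option]
    have : ∀ p, L (some p) *ᵥ ψ = 0 := fun p => by
      change (single m p 1 * R) *ᵥ ψ = 0
      rw [← mulVec_mulVec, hRψ, mulVec_zero]
    simp [this, pureState, show L none = K from rfl]

/-- States in a subspace of dimension at most `2 ^ Q` can be compressed into `Q` qubits. -/
theorem exactlyCompressible_of_finrank_le {P X : Type*} [Fintype P] [Nonempty P]
    (S : Submodule ℂ (P → ℂ)) (ψ : X → P → ℂ) (hψ : ∀ x, ψ x ∈ S) (Q : ℕ)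
    (hQ : Module.finrank ℂ S ≤ 2 ^ Q) : ExactlyCompressible ψ Q := by
  classical
  let S' : Submodule ℂ (EuclideanSpace ℂ P) :=
    S.map (WithLp.linearEquiv 2 ℂ (P → ℂ)).symm.toLinearMap
  have hS' : Module.finrank ℂ S' = Module.finrank ℂ S := LinearEquiv.finrank_map_eq _ _
  let e := stdOrthonormalBasis ℂ S'
  obtain ⟨ι⟩ : Nonempty (Fin (Module.finrank ℂ S') ↪ (Fin Q → Fin 2)) :=
    Function.Embedding.nonempty_of_card_le (by simpa [hS'] using hQ)
  let U : Matrix P (Fin (Module.finrank ℂ S')) ℂ := .of fun p j => (e j : EuclideanSpace ℂ P) p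
  let J : Matrix (Fin Q → Fin 2) (Fin (Module.finrank ℂ S')) ℂ := .of fun m j =>
    if ι j = m then 1 else 0
  have hU : Uᴴ * U = 1 := by
    ext i j
    have := orthonormal_iff_ite.1 e.orthonormal i j
    rw [Submodule.coe_inner, PiLp.inner_apply] at this
    simp only [mul_apply, conjTranspose_apply, U, of_apply, one_apply]
    rw [← this]
    exact Finset.sum_congr rfl fun p _ => mul_comm _ _
  have hJ : Jᴴ * J = 1 := by
    ext i j
    simp [mul_apply, J, one_apply, ι.injective.eq_iff, eq_comm]
  have hUψ : ∀ x, (U * Uᴴ) *ᵥ ψ x = ψ x := by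
    intro x
    have hx : WithLp.toLp 2 (ψ x) ∈ S' := ⟨ψ x, hψ x, rfl⟩
    have h1 := e.sum_repr' ⟨_, hx⟩
    have h2 := congrArg (fun y : S' => WithLp.ofLp (y : EuclideanSpace ℂ P)) h1
    simp only at h2
    ext p
    have h3 := congrFun h2 p
    simp only [Submodule.coe_sum, Submodule.coe_smul, WithLp.ofLp_sum, WithLp.ofLp_smul,
      Finset.sum_apply, Pi.smul_apply, smul_eq_mul] at h3
    rw [← mulVec_mulVec]
    refine Eq.trans ?_ h3
    simp only [mulVec, dotProduct, U, of_apply, conjTranspose_apply, Submodule.coe_inner,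
      PiLp.inner_apply]
    refine Finset.sum_congr rfl fun j _ => ?_
    rw [mul_comm]
    congr 1
    exact Finset.sum_congr rfl fun p _ => mul_comm _ _
  -- `U` and `J` are isometries from `ℂ^r` onto `S` and into the qubit space. So `K` and `Kᴴ` are
  -- partial isometries, one used to encode and the other to decode.
  let K := J * Uᴴ
  have hK1 : Kᴴ * K = U * Uᴴ := by
    simp only [K, conjTranspose_mul, conjTranspose_conjTranspose]
    rw [Matrix.mul_assoc, ← Matrix.mul_assoc Jᴴ, hJ, Matrix.one_mul]
  have hK2 : Kᴴᴴ * Kᴴ = J * Jᴴ := by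
    simp only [K, conjTranspose_mul, conjTranspose_conjTranspose]
    rw [Matrix.mul_assoc, ← Matrix.mul_assoc Uᴴ, hU, Matrix.one_mul]
  obtain ⟨enc, henc, henc'⟩ := exists_isChannel_of_isIdempotentElem K (by
    rw [hK1, IsIdempotentElem, Matrix.mul_assoc, ← Matrix.mul_assoc Uᴴ, hU, Matrix.one_mul])
  obtain ⟨dec, hdec, hdec'⟩ := exists_isChannel_of_isIdempotentElem Kᴴ (by
    rw [hK2, IsIdempotentElem, Matrix.mul_assoc, ← Matrix.mul_assoc Jᴴ, hJ, Matrix.one_mul])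
  refine ⟨enc, dec, henc, hdec, fun x => ?_⟩
  rw [henc' _ (by rw [hK1, hUψ]), hdec', mulVec_mulVec, hK1, hUψ]
  rw [mulVec_mulVec, hK2]
  simp only [K]
  rw [Matrix.mul_assoc, ← Matrix.mul_assoc Jᴴ, hJ, Matrix.one_mul]

/-- A linear map fixing all pure states of a subspace fixes all `|φ⟩⟨χ|` with `φ`, `χ` in it. -/
theorem map_vecMulVec_eq_of_map_pureState {P : Type*} [Fintype P]
    (S : Submodule ℂ (P → ℂ)) (Φ : Matrix P P ℂ →ₗ[ℂ] Matrix P P ℂ)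
    (h : ∀ ψ ∈ S, ∑ p, ‖ψ p‖ ^ 2 = 1 → Φ (pureState ψ) = pureState ψ)
    {φ χ : P → ℂ} (hφ : φ ∈ S) (hχ : χ ∈ S) :
    Φ (vecMulVec φ (star χ)) = vecMulVec φ (star χ) := by
  have h' : ∀ ψ ∈ S, Φ (vecMulVec ψ (star ψ)) = vecMulVec ψ (star ψ) := by
    intro ψ hψ
    by_cases h0 : ∑ p, ‖ψ p‖ ^ 2 = 0
    · have : ψ = 0 := by
        ext p
        have := (Finset.sum_eq_zero_iff_of_nonneg fun p _ => sq_nonneg ‖ψ p‖).1 h0 p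
          (Finset.mem_univ p)
        simpa using this
      simp [this]
    · set c : ℝ := ∑ p, ‖ψ p‖ ^ 2 with hc
      have hcpos : 0 < c := lt_of_le_of_ne (Finset.sum_nonneg fun p _ => sq_nonneg _) (Ne.symm h0)
      have hs : (Real.sqrt c) ≠ 0 := (Real.sqrt_pos.2 hcpos).ne'
      have hs' : (Real.sqrt c : ℂ) ≠ 0 := by exact_mod_cast hs
      have hunit : ∑ p, ‖(((Real.sqrt c : ℂ)⁻¹) • ψ) p‖ ^ 2 = 1 := by
        simp only [Pi.smul_apply, norm_smul, mul_pow, ← Finset.mul_sum, ← hc]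
        rw [norm_inv, Complex.norm_real, inv_pow, Real.norm_eq_abs, sq_abs, Real.sq_sqrt hcpos.le,
          inv_mul_cancel₀ h0]
      have hu := h _ (S.smul_mem _ hψ) hunit
      rw [pureState, star_smul, smul_vecMulVec, vecMulVec_smul, map_smul, map_smul] at hu
      have hs'' : star ((Real.sqrt c : ℂ)⁻¹) ≠ 0 := by simpa using hs
      exact smul_right_injective _ hs'' (smul_right_injective _ (inv_ne_zero hs') hu)
  -- Polarisation: the vectors `φ + χ` and `φ + iχ` isolate the cross term `|φ⟩⟨χ|`.
  have h1 := h' _ (S.add_mem hφ hχ)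
  have h2 := h' _ (S.add_mem hφ (S.smul_mem Complex.I hχ))
  have h3 := h' _ hφ
  have h4 := h' _ hχ
  simp only [star_add, star_smul, add_vecMulVec, vecMulVec_add, map_add, smul_vecMulVec,
    vecMulVec_smul, map_smul, h3, h4, RCLike.star_def, Complex.conj_I] at h1 h2
  have h5 : Φ (vecMulVec φ (star χ)) + Φ (vecMulVec χ (star φ)) =
      vecMulVec φ (star χ) + vecMulVec χ (star φ) := by
    linear_combination (norm := module) h1
  have h6 : -Complex.I • Φ (vecMulVec φ (star χ)) + Complex.I • Φ (vecMulVec χ (star φ)) =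
      -Complex.I • vecMulVec φ (star χ) + Complex.I • vecMulVec χ (star φ) := by
    linear_combination (norm := module) h2
  have h7 : (2 * Complex.I) • Φ (vecMulVec φ (star χ)) =
      (2 * Complex.I) • vecMulVec φ (star χ) := by
    linear_combination (norm := module) Complex.I • h5 - h6
  exact smul_right_injective _ (by simp : (2 * Complex.I) ≠ 0) h7

/-- If all unit vectors of a subspace can be compressed into `Q` qubits by fixed maps, then its
dimension is at most `2 ^ Q`. -/
theorem finrank_le_of_exactlyCompressible {P X : Type*} [Fintype P]
    (S : Submodule ℂ (P → ℂ)) (ψ : X → P → ℂ)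
    (hψ : ∀ φ ∈ S, ∑ p, ‖φ p‖ ^ 2 = 1 → ∃ x, ψ x = φ) (Q : ℕ) (h : ExactlyCompressible ψ Q) :
    Module.finrank ℂ S ≤ 2 ^ Q := by
  classical
  obtain ⟨enc, dec, -, -, hed⟩ := h
  set r := Module.finrank ℂ S with hr
  let e : Module.Basis (Fin r) ℂ S := Module.finBasis ℂ S
  have hfix : ∀ i j, (dec ∘ₗ enc) (vecMulVec (e i : P → ℂ) (star (e j : P → ℂ))) =
      vecMulVec (e i : P → ℂ) (star (e j : P → ℂ)) := fun i j =>
    map_vecMulVec_eq_of_map_pureState S _ (fun φ hφ h1 => by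
      obtain ⟨x, rfl⟩ := hψ φ hφ h1
      exact hed x) (e i).2 (e j).2
  have he : LinearIndependent ℂ fun i => (e i : P → ℂ) :=
    e.linearIndependent.map' S.subtype (Submodule.ker_subtype S)
  have hli : LinearIndependent ℂ fun ij : Fin r × Fin r =>
      vecMulVec (e ij.1 : P → ℂ) (star (e ij.2 : P → ℂ)) := by
    rw [Fintype.linearIndependent_iff]
    intro g hg
    have h1 : ∀ q i, ∑ j, g (i, j) * star ((e j : P → ℂ) q) = 0 := by
      intro q
      refine Fintype.linearIndependent_iff.1 he _ ?_
      ext p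
      have := congrFun (congrFun hg p) q
      simp only [Fintype.sum_prod_type, Matrix.sum_apply, Matrix.smul_apply, vecMulVec_apply,
        Pi.star_apply, smul_eq_mul, Matrix.zero_apply] at this
      simp only [Finset.sum_apply, Pi.smul_apply, smul_eq_mul, Pi.zero_apply, Finset.sum_mul]
      rw [← this]
      exact Finset.sum_congr rfl fun i _ => Finset.sum_congr rfl fun j _ => by ring
    rintro ⟨i, j⟩
    have h2 := Fintype.linearIndependent_iff.1 he (fun j => star (g (i, j))) (by
      ext q
      have := congrArg star (h1 q i)
      simpa [mul_comm] using this) j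
    simpa using h2
  -- Since `dec` recovers these `r * r` operators, their encodings are independent in a space of
  -- dimension `2 ^ Q * 2 ^ Q`.
  have hli2 : LinearIndependent ℂ fun ij : Fin r × Fin r =>
      enc (vecMulVec (e ij.1 : P → ℂ) (star (e ij.2 : P → ℂ))) := by
    refine LinearIndependent.of_comp dec ?_
    convert hli using 1
    ext1 ij
    exact hfix ij.1 ij.2
  have hcard := hli2.fintype_card_le_finrank
  rw [Module.finrank_matrix, Fintype.card_prod, Fintype.card_fin] at hcard
  simp only [Fintype.card_pi, Fintype.card_fin, Finset.prod_const, Finset.card_univ,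
    Module.finrank_self, mul_one] at hcard
  exact Nat.mul_self_le_mul_self_iff.1 hcard


/-! ### Upper bound: factoring the contraction across a cut -/

/-- If `F i` depends only on the coordinates in `s ∪ c`, and `G o` only on those in `sᶜ ∪ c`, then
the matrix `∑ a, G o a * F i a` factors through the coordinates in `c`. -/
theorem rank_sum_mul_le {E : Type*} [Fintype E] [DecidableEq E] {X : E → Type*}
    [∀ e, Fintype (X e)] [∀ e, Nonempty (X e)] {I O : Type*} [Fintype I] [Fintype O]
    (s c : E → Prop) [DecidablePred s] [DecidablePred c]
    (F : I → (∀ e, X e) → ℂ) (G : O → (∀ e, X e) → ℂ)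
    (hF : ∀ i a a', (∀ e, s e ∨ c e → a e = a' e) → F i a = F i a')
    (hG : ∀ o a a', (∀ e, ¬ s e ∨ c e → a e = a' e) → G o a = G o a') :
    (Matrix.of fun o i => ∑ a, G o a * F i a).rank ≤ ∏ e : {e // c e}, Fintype.card (X e) := by
  classical
  let x₀ : ∀ e, X e := fun e => Classical.arbitrary _
  let comb : (∀ e : {e // c e}, X e) → (∀ e : {e : {e // ¬ c e} // s e}, X e) →
      (∀ e : {e : {e // ¬ c e} // ¬ s e}, X e) → ∀ e, X e := fun κ x y e =>
    if hc : c e then κ ⟨e, hc⟩ else if hs : s e then x ⟨⟨e, hc⟩, hs⟩ else y ⟨⟨e, hc⟩, hs⟩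
  -- `G` does not see the block `x` and `F` does not see `y`, so the unseen block is frozen at `x₀`
  -- and the sum splits into a matrix product over `κ`.
  let L : Matrix O (∀ e : {e // c e}, X e) ℂ := .of fun o κ =>
    ∑ y, G o (comb κ (fun e => x₀ e) y)
  let R : Matrix (∀ e : {e // c e}, X e) I ℂ := .of fun κ i =>
    ∑ x, F i (comb κ x fun e => x₀ e)
  have key : (Matrix.of fun o i => ∑ a, G o a * F i a) = L * R := by
    ext o i
    simp only [Matrix.of_apply, Matrix.mul_apply, L, R]
    rw [← (Equiv.piEquivPiSubtypeProd c X).symm.sum_comp, Fintype.sum_prod_type]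
    refine Finset.sum_congr rfl fun κ _ => ?_
    rw [← (Equiv.piEquivPiSubtypeProd (fun e : {e // ¬ c e} => s e) fun e => X e).symm.sum_comp,
      Fintype.sum_prod_type, Finset.sum_mul_sum, Finset.sum_comm]
    refine Finset.sum_congr rfl fun y _ => Finset.sum_congr rfl fun x _ => ?_
    congr 1
    · refine hG _ _ _ fun e he => ?_
      by_cases hc : c e
      · simp [comb, hc]
      · have hs : ¬ s e := by tauto
        simp [comb, hc, hs]
    · refine hF _ _ _ fun e he => ?_
      by_cases hc : c e
      · simp [comb, hc]
      · have hs : s e := by tauto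
        simp [comb, hc, hs]
  rw [key]
  refine (Matrix.rank_mul_le_left _ _).trans ((Matrix.rank_le_card_width _).trans ?_)
  rw [Fintype.card_pi]

namespace Template

/-- The common base of the dimensions can be taken to be a positive natural number. -/
theorem exists_pos_nat_base {V : Type u} (T : Template V) {b : ℤ} {n : T.E → ℕ}
    (hd : ∀ e, (T.d e : ℤ) = b ^ n e) :
    ∃ c : ℕ, 0 < c ∧ ∀ e, T.d e = c ^ n e := by
  have h : ∀ e, T.d e = b.natAbs ^ n e := fun e => by
    rw [← Int.natAbs_pow, ← hd, Int.natAbs_natCast]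
  rcases Nat.eq_zero_or_pos b.natAbs with h0 | h0
  -- For `b = 0`, positivity of the dimensions forces every exponent to be `0`, so the base `1`
  -- serves as well.
  · refine ⟨1, one_pos, fun e => ?_⟩
    have h1 := h e
    have h2 := T.d_pos e
    rw [h0] at h1
    rcases Nat.eq_zero_or_pos (n e) with hn | hn
    · simpa [hn] using h1
    · rw [zero_pow hn.ne'] at h1
      omega
  · exact ⟨_, h0, h⟩

variable {V : Type u} [DecidableEq V] (T : Template V)

theorem fst_or_snd_mem_filled (e : T.E) : e.1.1 ∈ T.filled ∨ e.1.2 ∈ T.filled := by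
  by_contra! h
  obtain ⟨w, hw, hx⟩ := T.empty_adj _ h.1
  have := (hx e.1.2).1 (Or.inl e.2)
  exact h.2 (this ▸ hw)

theorem sum_edges {M : Type*} [AddCommMonoid M] (g : T.E → M) :
    ∑ e, g e = ((∑ e : T.InEdge, g e.1) + ∑ e : T.OutEdge, g e.1) +
      ∑ e : T.InternalEdge, g e.1 := by
  have h : ∀ (p : T.E → Prop) [DecidablePred p],
      ∑ e : {e // p e}, g e.1 = ∑ e, if p e then g e else 0 := fun p _ => by
    rw [← Finset.sum_filter]
    exact (Finset.sum_subtype _ (by simp only [Finset.mem_filter_univ, implies_true]) g).symm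
  rw [h, h, h, ← Finset.sum_add_distrib, ← Finset.sum_add_distrib]
  refine Finset.sum_congr rfl fun e _ => ?_
  have := T.fst_or_snd_mem_filled e
  by_cases h1 : e.1.1 ∈ T.filled <;> by_cases h2 : e.1.2 ∈ T.filled <;> simp_all

/-- The tail of `e` lies on the source side of the cut `C` (an empty tail counts as the
source). -/
def TailSide (C : Set T.FlowVertex) (e : T.E) : Prop :=
  ∀ h : e.1.1 ∈ T.filled, Sum.inl ⟨e.1.1, h⟩ ∈ C

/-- The head of `e` lies on the source side of the cut `C` (an empty head counts as the sink). -/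
def HeadSide (C : Set T.FlowVertex) (e : T.E) : Prop :=
  ∃ h : e.1.2 ∈ T.filled, Sum.inl ⟨e.1.2, h⟩ ∈ C

/-- The edge `e` crosses the cut `C`. -/
def Crosses (C : Set T.FlowVertex) (e : T.E) : Prop :=
  ¬ (T.TailSide C e ↔ T.HeadSide C e)

-- Of the two copies of an internal edge, exactly one runs from `C` to its complement when the ends
-- are separated, and none otherwise. This is why the undirected notion `Crosses` counts each edge
-- once.
open Classical in
theorem cutCapacity_eq_sum (C : Set T.FlowVertex) (hC : T.flowNetwork.IsCut C) :
    T.flowNetwork.cutCapacity C =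
      ∑ e : T.E, if T.Crosses C e then Real.logb 2 (T.d e) else 0 := by
  have hs : Sum.inr false ∈ C := hC.1
  have ht : Sum.inr true ∉ C := hC.2
  rw [FlowNetwork.cutCapacity, sum_edges, Fintype.sum_sum_type, Fintype.sum_sum_type,
    Fintype.sum_sum_type, ← Finset.sum_add_distrib]
  congr 1
  · congr 1
    · refine Finset.sum_congr rfl fun e _ => ?_
      simp [flowNetwork, FlowEdge.base, Crosses, TailSide, HeadSide, hs, e.2.1, e.2.2]
    · refine Finset.sum_congr rfl fun e _ => ?_
      simp [flowNetwork, FlowEdge.base, Crosses, TailSide, HeadSide, ht, e.2.1, e.2.2]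
  · refine Finset.sum_congr rfl fun e _ => ?_
    simp only [flowNetwork, FlowEdge.base, Crosses, TailSide, HeadSide, e.2.1, e.2.2,
      Sum.elim_inr, Sum.elim_inl, forall_true_left, exists_true_left]
    by_cases h1 : (Sum.inl ⟨e.1.1.1, e.2.1⟩ : T.FlowVertex) ∈ C <;>
    by_cases h2 : (Sum.inl ⟨e.1.1.2, e.2.2⟩ : T.FlowVertex) ∈ C <;> simp [h1, h2]

open Classical in
/-- The rank of a compatible operator is at most the product of the dimensions of the edges
crossing any cut. -/
theorem rank_le_prod (A : Matrix T.OutIndex T.InIndex ℂ) (hA : T.Compatible A)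
    (C : Set T.FlowVertex) : A.rank ≤ ∏ e : {e // T.Crosses C e}, T.d e := by
  obtain ⟨N, rfl⟩ := hA
  have hne : ∀ e : T.E, Nonempty (Fin (T.d e)) := fun e => ⟨⟨0, T.d_pos e⟩⟩
  -- `F` collects the inputs and the tensors in `C`, `G` the outputs and the remaining tensors. A
  -- non-crossing edge has both ends on the same side, so it is seen by at most one of the two.
  let F : T.InIndex → (∀ e : T.E, Fin (T.d e)) → ℂ := fun i a =>
    if ∀ e : T.InEdge, a e.1 = i e then
      ∏ v : T.filled, if Sum.inl v ∈ C then N v (fun e => a e.1) else 1 else 0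
  let G : T.OutIndex → (∀ e : T.E, Fin (T.d e)) → ℂ := fun o a =>
    if ∀ e : T.OutEdge, a e.1 = o e then
      ∏ v : T.filled, if Sum.inl v ∈ C then 1 else N v (fun e => a e.1) else 0
  have key : operator N = Matrix.of fun o i => ∑ a, G o a * F i a := by
    ext o i
    simp only [operator, Matrix.of_apply]
    refine Finset.sum_congr rfl fun a _ => ?_
    by_cases h1 : ∀ e : T.InEdge, a e.1 = i e <;> by_cases h2 : ∀ e : T.OutEdge, a e.1 = o e
    · simp only [F, G, h1, h2, implies_true, and_self, if_true]
      rw [← Finset.prod_mul_distrib]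
      refine Finset.prod_congr rfl fun v _ => ?_
      split_ifs <;> simp
    · simp only [F, G]
      rw [if_neg (fun h => h2 h.2), if_neg h2, zero_mul]
    · simp only [F, G]
      rw [if_neg (fun h => h1 h.1), if_neg h1, mul_zero]
    · simp only [F, G]
      rw [if_neg (fun h => h1 h.1), if_neg h1, mul_zero]
  rw [key]
  refine (rank_sum_mul_le (fun e => T.TailSide C e ∧ T.HeadSide C e) (T.Crosses C) F G
    ?_ ?_).trans_eq (by simp)
  · intro i a a' haa
    have h1 : (∀ e : T.InEdge, a e.1 = i e) ↔ ∀ e : T.InEdge, a' e.1 = i e := by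
      refine forall_congr' fun e => ?_
      rw [haa e.1]
      have : T.TailSide C e.1 := fun h => (e.2.1 h).elim
      simp only [Crosses, this]
      tauto
    simp only [F, h1]
    congr 1
    refine Finset.prod_congr rfl fun v _ => ?_
    split_ifs with hv
    · congr 1
      ext1 e
      refine haa e.1 ?_
      have : T.TailSide C e.1 ∨ T.HeadSide C e.1 := by
        rcases e.2 with h | h
        · left
          intro h'
          rwa [show (⟨e.1.1.1, h'⟩ : T.filled) = v from Subtype.ext h]
        · right
          have h' : e.1.1.2 ∈ T.filled := by rw [h]; exact v.2
          refine ⟨h', ?_⟩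
          rwa [show (⟨e.1.1.2, h'⟩ : T.filled) = v from Subtype.ext h]
      simp only [Crosses]
      tauto
    · rfl
  · intro i a a' haa
    have h1 : (∀ e : T.OutEdge, a e.1 = i e) ↔ ∀ e : T.OutEdge, a' e.1 = i e := by
      refine forall_congr' fun e => ?_
      rw [haa e.1]
      have : ¬ T.HeadSide C e.1 := fun ⟨h, _⟩ => (e.2.2 h).elim
      simp only [Crosses, this]
      tauto
    simp only [G, h1]
    congr 1
    refine Finset.prod_congr rfl fun v _ => ?_
    split_ifs with hv
    · rfl
    · congr 1
      ext1 e
      refine haa e.1 ?_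
      have : ¬ T.TailSide C e.1 ∨ ¬ T.HeadSide C e.1 := by
        rcases e.2 with h | h
        · left
          intro h'
          have h'' : e.1.1.1 ∈ T.filled := by rw [h]; exact v.2
          refine hv ?_
          rw [show v = (⟨e.1.1.1, h''⟩ : T.filled) from Subtype.ext h.symm]
          exact h' h''
        · right
          rintro ⟨h', h''⟩
          refine hv ?_
          rwa [show v = (⟨e.1.1.2, h'⟩ : T.filled) from Subtype.ext h.symm]
      simp only [Crosses]
      tauto

theorem logb_rank_le_minCut (A : Matrix T.OutIndex T.InIndex ℂ) (hA : T.Compatible A) :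
    Real.logb 2 A.rank ≤ T.flowNetwork.minCut := by
  classical
  obtain ⟨C, hC, hcap⟩ := T.flowNetwork.isLeast_minCut.1
  have hprod : T.flowNetwork.minCut =
      Real.logb 2 ((∏ e : {e // T.Crosses C e}, T.d e : ℕ) : ℝ) := by
    rw [hcap, T.cutCapacity_eq_sum C hC, Nat.cast_prod, Real.logb_prod _ _ fun e _ => by
      exact_mod_cast (T.d_pos _).ne']
    rw [← Finset.sum_filter]
    exact Finset.sum_subtype _ (by simp only [Finset.mem_filter_univ, implies_true])
      fun e => Real.logb 2 (T.d e : ℝ)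
  rw [hprod]
  rcases Nat.eq_zero_or_pos A.rank with h0 | h0
  · rw [h0, Nat.cast_zero, Real.logb_zero]
    exact Real.logb_nonneg (by norm_num) (by
      exact_mod_cast Nat.one_le_iff_ne_zero.2 (Finset.prod_ne_zero_iff.2 fun e _ =>
        (T.d_pos _).ne'))
  · refine Real.logb_le_logb_of_le (by norm_num) (by exact_mod_cast h0) ?_
    exact_mod_cast T.rank_le_prod A hA C


/-! ### Lower bound: disjoint chains of slots and the operator they define -/

/-- The pairs `(e, i)` with `e` an edge and `i < n e`: the edges of the multigraph in which each
edge `e` is replaced by `n e` parallel edges. -/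
abbrev Slot (n : T.E → ℕ) : Type u := Σ e : T.E, Fin (n e)

variable {T}

/-- The slot `x` is incident on the vertex `v`. -/
def Slot.Inc {n : T.E → ℕ} (x : T.Slot n) (v : V) : Prop := x.1.1.1 = v ∨ x.1.1.2 = v

/-- Two slots are linked if they are incident on a common filled vertex. -/
def Slot.Link {n : T.E → ℕ} (x y : T.Slot n) : Prop := ∃ v ∈ T.filled, x.Inc v ∧ y.Inc v

open Classical in
/-- If all cuts have at least `k` slots, so have all sets of slots separating the ingoing from the
outgoing ones. -/
theorem le_card_of_separates {n : T.E → ℕ} {k : ℕ}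
    (hk : ∀ C : Set T.FlowVertex, T.flowNetwork.IsCut C →
      k ≤ ∑ e : T.E, if T.Crosses C e then n e else 0)
    (S : Finset (T.Slot n))
    (hS : ∀ x : T.Slot n, x.1.1.1 ∉ T.filled → ∀ y : T.Slot n, y.1.1.2 ∉ T.filled → x ∉ S →
      ¬ ReflTransGen (fun u v => u.Link v ∧ v ∉ S) x y) : k ≤ S.card := by
  set reach : T.Slot n → Prop := fun y => ∃ x : T.Slot n, x.1.1.1 ∉ T.filled ∧ x ∉ S ∧
    ReflTransGen (fun u v => u.Link v ∧ v ∉ S) x y with hreach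
  -- The source side consists of `s` and the filled vertices touched by a slot reachable from the
  -- inputs outside `S`. A crossing slot outside `S` would extend reachability over the cut or, at
  -- an output, contradict separation.
  set C : Set T.FlowVertex := {w | w = .inr false ∨
    ∃ v, w = .inl v ∧ ∃ y, reach y ∧ y.Inc v} with hC
  have hmem : ∀ v, Sum.inl v ∈ C ↔ ∃ y, reach y ∧ y.Inc v := fun v => by simp [hC]
  have hcut : T.flowNetwork.IsCut C := ⟨Or.inl rfl, by simp [hC, flowNetwork]⟩
  have fact1 : ∀ v (x : T.Slot n), Sum.inl v ∈ C → x.Inc v → x ∉ S → reach x := by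
    intro v x hv hxv hxS
    obtain ⟨y, ⟨x₀, h1, h2, h3⟩, hyv⟩ := (hmem v).1 hv
    exact ⟨x₀, h1, h2, h3.tail ⟨⟨v, v.2, hyv, hxv⟩, hxS⟩⟩
  have fact2 : ∀ (v : T.filled) (x : T.Slot n), reach x → x.Inc v → Sum.inl v ∈ C :=
    fun v x hx hxv => (hmem v).2 ⟨x, hx, hxv⟩
  have hcross : ∀ x : T.Slot n, T.Crosses C x.1 → x ∈ S := by
    intro x hx
    by_contra hxS
    refine hx ⟨fun ht => ?_, fun ⟨hf, hh⟩ => ?_⟩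
    · have hr : reach x := by
        by_cases hf : x.1.1.1 ∈ T.filled
        · exact fact1 _ x (ht hf) (Or.inl rfl) hxS
        · exact ⟨x, hf, hxS, .refl⟩
      have hf : x.1.1.2 ∈ T.filled := by
        by_contra hf
        obtain ⟨x₀, h1, h2, h3⟩ := hr
        exact hS x₀ h1 x hf h2 h3
      exact ⟨hf, fact2 ⟨_, hf⟩ x hr (Or.inr rfl)⟩
    · exact fun h => fact2 ⟨_, h⟩ x (fact1 _ x hh (Or.inr rfl) hxS) (Or.inl rfl)
  refine (hk C hcut).trans ?_
  have hcard : ∑ e : T.E, (if T.Crosses C e then n e else 0) =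
      ((Finset.univ.filter fun e => T.Crosses C e).sigma
        fun e => (Finset.univ : Finset (Fin (n e)))).card := by
    simp [Finset.card_sigma, Finset.sum_filter]
  rw [hcard]
  refine Finset.card_le_card fun x hx => hcross x ?_
  simpa using hx

/-- The index of an edge of dimension `b ^ n e` as a string of `n e` digits. -/
def digits {b : ℕ} {n : T.E → ℕ} (hd : ∀ e, T.d e = b ^ n e) (e : T.E) :
    Fin (T.d e) ≃ (Fin (n e) → Fin b) :=
  (finCongr (hd e)).trans finFunctionFinEquiv.symm

/-- The filling whose tensor at `v` is the indicator function of the assignments which, for each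
`j`, give the same digit to all slots at `v` belonging to `F j`. -/
def linkFilling {b : ℕ} {n : T.E → ℕ} (hd : ∀ e, T.d e = b ^ n e) {k : ℕ}
    (F : Fin k → Set (T.Slot n)) : T.Filling :=
  open Classical in fun v t =>
    if ∀ (x y : T.Slot n) (hx : x.Inc v.1) (hy : y.Inc v.1) (j : Fin k), x ∈ F j → y ∈ F j →
      digits hd x.1 (t ⟨x.1, hx⟩) x.2 = digits hd y.1 (t ⟨y.1, hy⟩) y.2 then 1 else 0

/-- `k` disjoint chains from the ingoing to the outgoing slots give a compatible operator of rank
at least `b ^ k`. -/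
theorem pow_le_rank_linkFilling {b : ℕ} (hb : 0 < b) {n : T.E → ℕ}
    (hd : ∀ e, T.d e = b ^ n e) {k : ℕ} (F : Fin k → Set (T.Slot n))
    (hF : ∀ i j x, x ∈ F i → x ∈ F j → i = j)
    (hchain : ∀ j, ∃ x : T.Slot n, x.1.1.1 ∉ T.filled ∧ ∃ y : T.Slot n, y.1.1.2 ∉ T.filled ∧
      x ∈ F j ∧ ReflTransGen (fun u v => u.Link v ∧ u ∈ F j ∧ v ∈ F j) x y) :
    b ^ k ≤ (operator (linkFilling hd F)).rank := by
  classical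
  -- The digit `f j` is put on every slot of `F j`; slots in no `F j` receive the arbitrary digit
  -- `0`.
  let asg : (Fin k → Fin b) → ∀ e : T.E, Fin (T.d e) := fun f e =>
    (digits hd e).symm fun i => if h : ∃ j, (⟨e, i⟩ : T.Slot n) ∈ F j then f h.choose else ⟨0, hb⟩
  have hasg : ∀ f (x : T.Slot n) j, x ∈ F j → digits hd x.1 (asg f x.1) x.2 = f j := by
    intro f x j hx
    have h : ∃ j, (⟨x.1, x.2⟩ : T.Slot n) ∈ F j := ⟨j, hx⟩
    simp only [asg, Equiv.apply_symm_apply, dif_pos h]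
    rw [hF _ _ _ h.choose_spec hx]
  have hprod : ∀ a : ∀ e : T.E, Fin (T.d e),
      ∏ v : T.filled, linkFilling hd F v (fun e => a e.1) =
        if ∀ (x y : T.Slot n) (j : Fin k), x.Link y → x ∈ F j → y ∈ F j →
          digits hd x.1 (a x.1) x.2 = digits hd y.1 (a y.1) y.2 then 1 else 0 := by
    intro a
    split_ifs with h
    · exact Finset.prod_eq_one fun v _ => if_pos fun x y hx hy j hxj hyj =>
        h x y j ⟨v, v.2, hx, hy⟩ hxj hyj
    · push Not at h
      obtain ⟨x, y, j, ⟨v, hv, hx, hy⟩, hxj, hyj, hne⟩ := h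
      refine Finset.prod_eq_zero (Finset.mem_univ (⟨v, hv⟩ : T.filled)) (if_neg fun h => ?_)
      exact hne (h x y hx hy j hxj hyj)
  -- Digits off the chains may vary freely on internal edges, so a diagonal entry is a count,
  -- positive because `asg f` itself is consistent.
  let c : (Fin k → Fin b) → ℕ := fun f => (Finset.univ.filter fun a : ∀ e : T.E, Fin (T.d e) =>
    ((∀ e : T.InEdge, a e.1 = asg f e.1) ∧ (∀ e : T.OutEdge, a e.1 = asg f e.1)) ∧
    ∀ (x y : T.Slot n) (j : Fin k), x.Link y → x ∈ F j → y ∈ F j →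
          digits hd x.1 (a x.1) x.2 = digits hd y.1 (a y.1) y.2).card
  have hc : ∀ f, (c f : ℂ) ≠ 0 := by
    intro f
    rw [Nat.cast_ne_zero]
    refine (Finset.card_pos.2 ⟨asg f, ?_⟩).ne'
    simp only [Finset.mem_filter, Finset.mem_univ, true_and, implies_true, and_self]
    intro x y j _ hx hy
    rw [hasg f x j hx, hasg f y j hy]
  -- Off the diagonal nothing survives: consistency carries the digit `f j` along chain `j` from its
  -- input slot to its output slot, where it must equal `g j`.
  have key : (operator (linkFilling hd F)).submatrix
      (fun f (e : T.OutEdge) => asg f e.1) (fun f (e : T.InEdge) => asg f e.1) =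
      Matrix.diagonal fun f => (c f : ℂ) := by
    ext g f
    simp only [operator, Matrix.submatrix_apply, Matrix.of_apply, hprod, Matrix.diagonal_apply]
    split_ifs with hgf
    · subst hgf
      simp only [← ite_and]
      rw [Finset.sum_boole]
    · refine Finset.sum_eq_zero fun a _ => ?_
      rw [← ite_and, if_neg]
      rintro ⟨⟨hin, hout⟩, hcons⟩
      refine hgf (funext fun j => ?_)
      obtain ⟨x, hx, y, hy, hxj, hxy⟩ := hchain j
      have h1 : y ∈ F j ∧ digits hd x.1 (a x.1) x.2 = digits hd y.1 (a y.1) y.2 := by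
        clear hy
        induction hxy with
        | refl => exact ⟨hxj, rfl⟩
        | tail _ hbc ih => exact ⟨hbc.2.2, ih.2.trans (hcons _ _ j hbc.1 hbc.2.1 hbc.2.2)⟩
      have h2 := hin ⟨x.1, hx, (T.fst_or_snd_mem_filled x.1).resolve_left hx⟩
      have h3 := hout ⟨y.1, (T.fst_or_snd_mem_filled y.1).resolve_right hy, hy⟩
      simp only at h2 h3
      rw [h2, h3, hasg f x j hxj, hasg g y j h1.1] at h1
      exact h1.2.symm
  calc b ^ k = (Matrix.diagonal fun f => (c f : ℂ)).rank := by
        rw [Matrix.rank_diagonal]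
        simp [hc]
    _ ≤ _ := by
        rw [← key]
        exact Matrix.rank_submatrix_le _ _ _

/-! ### Max-flow equals min-cut, and the memory criterion -/

variable (T)

theorem minCut_le_quantumMaxFlow {b : ℕ} {n : T.E → ℕ} (hd : ∀ e, T.d e = b ^ n e) (hb : 0 < b) :
    T.flowNetwork.minCut ≤ T.quantumMaxFlow := by
  classical
  have hcap : ∀ C : Set T.FlowVertex, T.flowNetwork.IsCut C → T.flowNetwork.cutCapacity C =
      (∑ e : T.E, if T.Crosses C e then n e else 0 : ℕ) * Real.logb 2 b := by
    intro C hC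
    rw [T.cutCapacity_eq_sum C hC, Nat.cast_sum, Finset.sum_mul]
    refine Finset.sum_congr rfl fun e _ => ?_
    split_ifs
    · rw [hd, Nat.cast_pow, Real.logb_pow]
    · simp
  obtain ⟨C, hC, hmin⟩ := T.flowNetwork.isLeast_minCut.1
  set k : ℕ := ∑ e : T.E, if T.Crosses C e then n e else 0 with hk
  obtain ⟨A, hA, hrank⟩ : ∃ A, T.Compatible A ∧ b ^ k ≤ A.rank := by
    obtain rfl | hb1 : b = 1 ∨ 1 < b := by omega
    · exact ⟨_, ⟨_, rfl⟩, (by simp : 1 ^ k = 1 ^ 0).trans_le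
        (pow_le_rank_linkFilling hb hd (k := 0) Fin.elim0 (fun i => i.elim0) fun j => j.elim0)⟩
    · have hlog : 0 < Real.logb 2 b := Real.logb_pos (by norm_num) (by exact_mod_cast hb1)
      obtain ⟨F, hF, hchain⟩ := exists_disjoint_chains (Slot.Link (T := T) (n := n))
        {x | x.1.1.1 ∉ T.filled} {y | y.1.1.2 ∉ T.filled} k fun S hS =>
          le_card_of_separates (fun C' hC' => by
            have := T.flowNetwork.isLeast_minCut.2 ⟨C', hC', rfl⟩
            rw [hmin, hcap C hC, hcap C' hC'] at this
            exact_mod_cast le_of_mul_le_mul_right this hlog) S hS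
      exact ⟨_, ⟨_, rfl⟩, pow_le_rank_linkFilling hb hd F hF hchain⟩
  refine le_trans ?_ (T.isGreatest_quantumMaxFlow.2 ⟨A, hA, rfl⟩)
  rw [hmin, hcap C hC, ← hk, ← Real.logb_pow]
  refine Real.logb_le_logb_of_le (by norm_num) (by positivity) ?_
  exact_mod_cast hrank

theorem quantumMaxFlow_le_minCut : T.quantumMaxFlow ≤ T.flowNetwork.minCut := by
  obtain ⟨A, hA, h⟩ := T.isGreatest_quantumMaxFlow.1
  exact h ▸ T.logb_rank_le_minCut A hA

/-- `Q` qubits suffice if and only if all compatible operators have rank at most `2 ^ Q`. -/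
theorem sufficientMemory_iff (Q : ℕ) : T.SufficientMemory Q ↔
    ∀ A : Matrix T.OutIndex T.InIndex ℂ, T.Compatible A → A.rank ≤ 2 ^ Q := by
  have : Nonempty T.OutIndex := ⟨fun e => ⟨0, T.d_pos e.1⟩⟩
  constructor
  -- The worst family for `A` consists of all unit vectors in its range, indexed by themselves.
  · intro h A hA
    refine finrank_le_of_exactlyCompressible (LinearMap.range A.mulVecLin)
      (fun x : {φ : T.OutIndex → ℂ // φ ∈ LinearMap.range A.mulVecLin ∧ ∑ o, ‖φ o‖ ^ 2 = 1} => x.1)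
      (fun φ hφ h1 => ⟨⟨φ, hφ, h1⟩, rfl⟩) Q (h _ _ ?_)
    choose v hv using fun x : {φ : T.OutIndex → ℂ //
      φ ∈ LinearMap.range A.mulVecLin ∧ ∑ o, ‖φ o‖ ^ 2 = 1} => x.2.1
    exact ⟨A, v, hA, fun x => ⟨(hv x).symm, x.2.2⟩⟩
  · rintro h X ψ ⟨A, v, hA, hψ⟩
    exact exactlyCompressible_of_finrank_le (LinearMap.range A.mulVecLin) ψ
      (fun x => ⟨v x, (hψ x).1.symm⟩) Q (h A hA)

theorem isLeast_sufficientMemory :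
    IsLeast {Q : ℕ | T.SufficientMemory Q} T.Qmin := by
  constructor
  · refine (T.sufficientMemory_iff _).2 fun A hA => ?_
    -- Rank `0` is treated apart, since there `logb 2 0 = 0` is only a default value.
    rcases Nat.eq_zero_or_pos A.rank with h0 | h0
    · rw [h0]; exact Nat.zero_le _
    have h1 : Real.logb 2 A.rank ≤ (T.Qmin : ℝ) :=
      (T.isGreatest_quantumMaxFlow.2 ⟨A, hA, rfl⟩).trans (Nat.le_ceil _)
    rw [Real.logb_le_iff_le_rpow (by norm_num) (by exact_mod_cast h0), Real.rpow_natCast] at h1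
    exact_mod_cast h1
  · intro Q hQ
    obtain ⟨A, hA, h⟩ := T.isGreatest_quantumMaxFlow.1
    have h1 := (T.sufficientMemory_iff Q).1 hQ A hA
    refine Nat.ceil_le.2 ?_
    rw [h]
    rcases Nat.eq_zero_or_pos A.rank with h0 | h0
    · simp [h0]
    · rw [Real.logb_le_iff_le_rpow (by norm_num) (by exact_mod_cast h0), Real.rpow_natCast]
      exact_mod_cast h1

end Template
end TensorNetwork
end

theorem proposition2 {V : Type u} [DecidableEq V] [Finite V]
    (T : TensorNetwork.Template V) (b : ℤ) (n : T.E → ℕ)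
    (hd : ∀ e, (T.d e : ℤ) = b ^ n e) :
    T.quantumMaxFlow = T.flowNetwork.minCut ∧
      T.Qcut = T.Qmin ∧
      IsLeast {Q : ℕ | T.SufficientMemory Q} T.Qcut := by
  obtain ⟨c, hc, hd'⟩ := T.exists_pos_nat_base hd
  have h : T.quantumMaxFlow = T.flowNetwork.minCut :=
    le_antisymm T.quantumMaxFlow_le_minCut (T.minCut_le_quantumMaxFlow hd' hc)
  have hQ : T.Qcut = T.Qmin := by
    rw [TensorNetwork.Template.Qcut, TensorNetwork.Template.Qmin, h]
  exact ⟨h, hQ, hQ ▸ T.isLeast_sufficientMemory⟩
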